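/- Let $n\ge 1$ and let $P\subset\mathbb{R}^n$ be a convex polytope (the convex hull of a finite set, not necessarily full-dimensional). Let $\omega_n=\pi^{n/2}/\Gamma(1+n/2)$ be the volume of the unit ball, so that the unit sphere $\mathbb{S}^{n-1}$ has surface area $n\omega_n$. For a nonempty face $F$ of $P$ with centroid $\hat F$, let $\alpha_P(F)$ be the surface area measure of the solid inner angle $\{u\in\mathbb{S}^{n-1} : \hat F+\epsilon u\in P \text{ for some } \epsilon>0\}$. For a unit vector $u$ and a set $A$, let $A_u$ be the orthogonal projection of $A$ onto the hyperplane $u^\perp$. Let $u$ be uniformly distributed on $\mathbb{S}^{n-1}$. (a) For every nonempty proper face $F$ of $P$ (that is, $F\ne P$), the event that $F_u$ is a proper face of $P_u$ is measurable up to a null set, and $$\mathrm{Prob}\bigl[F_u\text{ is a proper face of }P_u\bigr]=1-\frac{2\alpha_P(F)}{n\omega_n}.$$ (b) For $0\le k\le n-1$, let $f_k(Q)$ be the number of proper $k$-dimensional faces of a polytope $Q$ ($Q$ is not counted as a face of itself). Then $u\mapsto f_k(P_u)$ is integrable and $$\mathrm{Exp}\bigl[f_k(P_u)\bigr]=\sum_{\dim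 F=k}\Bigl(1-\frac{2\alpha_P(F)}{n\omega_n}\Bigr)=f_k(P)-\frac{2}{n\omega_n}\sum_{\dim F=k}\alpha_P(F),$$ where the sums are over the proper $k$-dimensional faces $F$ of $P$. (c) If $0\le k\le n-1$ and moreover $k\le n-2$ or $\dim P<n$, then (b) also holds when each polytope is counted as a face of itself, both in $f_k$ and in the sums. -/

import Mathlib

open MeasureTheory

namespace AngleProjection

/-- Euclidean `n`-space. -/
abbrev E (n : ℕ) : Type := EuclideanSpace ℝ (Fin n)

/-- The unit sphere of Euclidean `n`-space, centred at the origin. -/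
abbrev S (n : ℕ) : Type := Metric.sphere (0 : E n) 1

/-- A convex polytope: the convex hull of finitely many points. -/
def IsPolytope {n : ℕ} (P : Set (E n)) : Prop :=
  ∃ s : Finset (E n), P = convexHull ℝ (s : Set (E n))

/-- The dimension of (the affine hull of) a nonempty set. -/
noncomputable def dim {n : ℕ} (A : Set (E n)) : ℕ :=
  Module.finrank ℝ (vectorSpan ℝ A)

/-- The nonempty faces of `P`: the nonempty sets of the form
`{x ∈ P | l x = max of l on P}` with `l` a linear functional. The choice `l = 0` gives `P` itself. -/
def faces {n : ℕ} (P : Set (E n)) : Set (Set (E n)) :=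
  {F | F.Nonempty ∧ IsExposed ℝ P F}

/-- The nonempty proper faces of `P`. -/
def properFaces {n : ℕ} (P : Set (E n)) : Set (Set (E n)) :=
  {F | F ∈ faces P ∧ F ≠ P}

/-- The nonempty `k`-dimensional faces of `P` (with `P` itself, if it has dimension `k`). -/
def kFaces {n : ℕ} (k : ℕ) (P : Set (E n)) : Set (Set (E n)) :=
  {F | F ∈ faces P ∧ dim F = k}

/-- The nonempty proper `k`-dimensional faces of `P`. -/
def properKFaces {n : ℕ} (k : ℕ) (P : Set (E n)) : Set (Set (E n)) :=
  {F | F ∈ properFaces P ∧ dim F = k}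

/-- A convex polytope has only finitely many faces, so that the face counts and the sums over
faces below are genuine. -/
theorem IsPolytope.finite_faces {n : ℕ} {P : Set (E n)} (hP : IsPolytope P) :
    (faces P).Finite := by
  obtain ⟨s, rfl⟩ := hP
  have hc : IsCompact (convexHull ℝ (s : Set (E n))) := s.finite_toSet.isCompact_convexHull (𝕜 := ℝ)
  refine Set.Finite.of_finite_image (f := fun F => F.extremePoints ℝ) ?_ ?_
  · refine (s.finite_toSet.finite_subsets).subset ?_
    rintro _ ⟨F, hF, rfl⟩
    exact (hF.2.isExtreme.extremePoints_subset_extremePoints).trans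
      extremePoints_convexHull_subset
  · intro F hF G hG h
    have key : ∀ H ∈ faces (convexHull ℝ (s : Set (E n))),
        closure (convexHull ℝ (H.extremePoints ℝ)) = H := fun H hH =>
      closure_convexHull_extremePoints (hH.2.isCompact hc)
        (hH.2.convex (convex_convexHull ℝ _))
    rw [← key F hF, ← key G hG]
    exact congrArg (fun A => closure (convexHull ℝ A)) h

/-- The centroid of `F`: the mean of the identity over `F` with respect to the
Hausdorff measure of dimension `dim F`. -/
noncomputable def centroid {n : ℕ} (F : Set (E n)) : E n :=
  ⨍ x in F, x ∂(μH[(dim F : ℝ)] : Measure (E n))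

/-- The solid inner angle of `P` at the point `v`. -/
def innerAngle {n : ℕ} (P : Set (E n)) (v : E n) : Set (S n) :=
  {u | ∃ ε : ℝ, 0 < ε ∧ v + ε • (u : E n) ∈ P}

/-- The surface area measure on the unit sphere; its total mass is `n * ω n`. -/
noncomputable def surfaceMeasure (n : ℕ) : Measure (S n) :=
  (volume : Measure (E n)).toSphere

/-- The measure `α_P(F)` of the solid inner angle of `P` at the centroid of `F`. -/
noncomputable def α {n : ℕ} (P F : Set (E n)) : ℝ :=
  (surfaceMeasure n).real (innerAngle P (centroid F))

/-- The volume of the unit ball in Euclidean `n`-space. -/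
noncomputable def ω (n : ℕ) : ℝ :=
  Real.pi ^ ((n : ℝ) / 2) / Real.Gamma (1 + (n : ℝ) / 2)

/-- The law of a random unit vector: normalised surface area measure. -/
noncomputable def uniformSphere (n : ℕ) : Measure (S n) :=
  (surfaceMeasure n Set.univ)⁻¹ • surfaceMeasure n

/-- The orthogonal projection `A_u` of `A` onto the hyperplane `u^⊥`, as a subset of `ℝⁿ`. -/
noncomputable def proj {n : ℕ} (u : S n) (A : Set (E n)) : Set (E n) :=
  (ℝ ∙ (u : E n))ᗮ.starProjection '' A

end AngleProjection

/-! Call a direction `u` generic if it is parallel to no proper face of `P`. There are finitely many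
proper faces and each spans a proper subspace, so almost every direction is generic (`ae_generic`).
For generic `u`, a proper face `F` survives projection iff neither `u` nor `-u` points from its
centroid into `P` (`proj_mem_properFaces_iff`). If one does, the part of `P` over `F_u` contains a
segment parallel to `u`; were `F_u` a proper face, that part would be a proper face parallel to `u`.
If neither does, the flat through `F` thickened by `u` misses the hull of the generators outside
`F`, and a separating functional descends to the projection (`proj_mem_properFaces`). The inner
angle and its antipode have equal measure and overlap only in directions parallel to `F`, a null
set; this gives (a). For generic `u`, taking preimages inverts `F ↦ F_u` on the surviving proper
`k`-faces (`ncard_properKFaces_proj`), so (b) is linearity of expectation. For (c), `P` and `P_u`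
either both add exactly 1 or almost surely neither is counted. -/

namespace AngleProjection

variable {n : ℕ}

/-! ### The centroid of a compact convex set -/

/-- The centroid of a compact convex set lies in its relative interior. -/
theorem exists_centroid_add_smul_mem {F : Set (E n)} (hc : IsCompact F) (hcv : Convex ℝ F)
    (hne : F.Nonempty) {w : E n} (hw : w ∈ vectorSpan ℝ F) :
    ∃ ε : ℝ, 0 < ε ∧ centroid F + ε • w ∈ F := by
  obtain ⟨a, ha⟩ := hne
  -- Move `F` isometrically into its own direction space, where it has nonempty interior and the
  -- Hausdorff measure of dimension `dim F` is a Haar measure.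
  set V := vectorSpan ℝ F with hV
  let L : V →L[ℝ] E n := V.subtypeL
  let φ : V → E n := fun x => L x + a
  have hφ : Isometry φ := by
    refine Isometry.of_dist_eq fun x y => ?_
    simp [φ, L, Subtype.dist_eq]
  set K : Set V := φ ⁻¹' F with hK
  have himg : φ '' K = F := by
    refine Set.image_preimage_eq_of_subset fun x hx => ?_
    exact ⟨⟨x - a, vsub_mem_vectorSpan ℝ hx ha⟩, by simp [φ, L]⟩
  have hKc : IsCompact K := hφ.isClosedEmbedding.isCompact_preimage hc
  have hKcv : Convex ℝ K := by
    have h1 : Convex ℝ ((fun z => z + a) ⁻¹' F) := hcv.translate_preimage_left a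
    exact h1.linear_preimage L.toLinearMap
  have h0 : (0 : V) ∈ K := by simpa [hK, φ] using ha
  have hspan : vectorSpan ℝ K = ⊤ := by
    let A : V →ᵃ[ℝ] E n := L.toLinearMap.toAffineMap + AffineMap.const ℝ V a
    have hA : ⇑A = φ := rfl
    have hAl : A.linear = V.subtype := by
      ext x; simp [A, L]
    have h1 := AffineMap.map_vectorSpan A (s := K)
    rw [hA, himg, hAl, ← hV] at h1
    apply Submodule.map_injective_of_injective V.injective_subtype
    rw [h1, Submodule.map_top, Submodule.range_subtype]
  have hint : (interior K).Nonempty := by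
    rw [hKcv.interior_nonempty_iff_affineSpan_eq_top,
      AffineSubspace.affineSpan_eq_top_iff_vectorSpan_eq_top_of_nonempty ℝ V V ⟨0, h0⟩]
    exact hspan
  set μ : Measure V := μH[(dim F : ℝ)]
  have : μ.IsAddHaarMeasure := isAddHaarMeasure_hausdorffMeasure
  have hKm : MeasurableSet K := hKc.isClosed.measurableSet
  have hKtop : μ K ≠ ⊤ := hKc.measure_lt_top.ne
  have hK0 : μ K ≠ 0 := (Measure.measure_pos_of_nonempty_interior μ hint).ne'
  have hint_id : IntegrableOn (fun x : V => x) K μ :=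
    continuous_id.continuousOn.integrableOn_compact hKc
  obtain ⟨b, hb⟩ := hint
  obtain ⟨r, hr, hrK⟩ := Metric.isOpen_iff.1 isOpen_interior b hb
  -- The average over a small ball inside `K` is an interior point; mixing it with the average over
  -- the rest of `K` stays in the interior.
  have hmem : (⨍ x in K, x ∂μ) ∈ interior K := by
    have : IsFiniteMeasure (μ.restrict K) := ⟨by simpa using hKc.measure_lt_top⟩
    have hsub : Metric.closedBall b (r / 2) ⊆ K :=
      (Metric.closedBall_subset_ball (by linarith)).trans (hrK.trans interior_subset)
    have hpos : μ (Metric.closedBall b (r / 2)) ≠ 0 :=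
      (Metric.measure_closedBall_pos μ b (by linarith)).ne'
    have hrs : (μ.restrict K).restrict (Metric.closedBall b (r / 2)) =
        μ.restrict (Metric.closedBall b (r / 2)) := by
      rw [Measure.restrict_restrict measurableSet_closedBall, Set.inter_eq_left.2 hsub]
    refine hKcv.average_mem_interior_of_set (t := Metric.closedBall b (r / 2)) ?_
      (ae_restrict_mem hKm) hint_id ?_
    · rwa [Measure.restrict_apply measurableSet_closedBall, Set.inter_eq_left.2 hsub]
    · rw [hrs]
      refine hrK (Metric.closedBall_subset_ball (by linarith : r / 2 < r) ?_)
      exact (convex_closedBall b (r / 2)).set_average_mem Metric.isClosed_closedBall hpos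
        (measure_closedBall_lt_top).ne (ae_restrict_mem measurableSet_closedBall)
        (hint_id.mono_set hsub)
  have hcent : centroid F = φ (⨍ x in K, x ∂μ) := by
    have hm : (μH[(dim F : ℝ)] : Measure (E n)).restrict F = (μ.restrict K).map φ := by
      have h1 := hφ.map_hausdorffMeasure (d := (dim F : ℝ)) (Or.inl (Nat.cast_nonneg _))
      have hFr : F ⊆ Set.range φ := by rw [← himg]; exact Set.image_subset_range _ _
      rw [hK, ← Measure.restrict_map hφ.continuous.measurable hc.isClosed.measurableSet, h1,
        Measure.restrict_restrict hc.isClosed.measurableSet, Set.inter_eq_left.2 hFr]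
    have huniv : (μ.restrict K).map φ Set.univ = μ K := by
      rw [Measure.map_apply hφ.continuous.measurable MeasurableSet.univ]; simp
    have hreal : μ.real K ≠ 0 := by
      simp [Measure.real, ENNReal.toReal_eq_zero_iff, hK0, hKtop]
    have hreal' : ((μ.restrict K).map φ).real Set.univ = μ.real K := by
      simp only [Measure.real, huniv]
    rw [centroid, hm, average_eq, average_eq, hreal', measureReal_restrict_apply_univ,
      integral_map (f := fun x => x) hφ.continuous.aemeasurable
        continuous_id.aestronglyMeasurable]
    have hL : Integrable (fun x => L x) (μ.restrict K) := L.integrable_comp hint_id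
    have : IsFiniteMeasure (μ.restrict K) := ⟨by simpa using hKc.measure_lt_top⟩
    simp only [φ]
    rw [integral_add hL (integrable_const a), L.integral_comp_comm hint_id, integral_const,
      smul_add, measureReal_restrict_apply_univ, smul_smul, inv_mul_cancel₀ hreal, one_smul,
      map_smul]
  set c := ⨍ x in K, x ∂μ
  have hcont : Filter.Tendsto (fun ε : ℝ => c + ε • (⟨w, hw⟩ : V)) (nhdsWithin 0 (Set.Ioi 0))
      (nhds c) := by
    have : Continuous (fun ε : ℝ => c + ε • (⟨w, hw⟩ : V)) := by fun_prop
    have h2 := this.tendsto 0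
    simp only [zero_smul, add_zero] at h2
    exact h2.mono_left nhdsWithin_le_nhds
  have hev := (hcont.eventually (isOpen_interior.mem_nhds hmem)).and self_mem_nhdsWithin
  obtain ⟨ε, hε, hε0⟩ := hev.exists
  refine ⟨ε, hε0, ?_⟩
  have := interior_subset hε
  rw [hcent]
  have h3 : φ c + ε • w = φ (c + ε • ⟨w, hw⟩) := by
    have h4 : L (c + ε • ⟨w, hw⟩) = L c + ε • w := by rw [map_add, map_smul]; rfl
    simp only [φ, h4]
    abel
  rw [h3]; exact this

theorem centroid_mem {F : Set (E n)} (hc : IsCompact F) (hcv : Convex ℝ F)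
    (hne : F.Nonempty) : centroid F ∈ F := by
  obtain ⟨ε, -, h⟩ := exists_centroid_add_smul_mem hc hcv hne (Submodule.zero_mem _)
  simpa using h

/-! ### Faces of polytopes -/

theorem IsPolytope.isCompact {P : Set (E n)} (hP : IsPolytope P) : IsCompact P := by
  obtain ⟨s, rfl⟩ := hP
  exact s.finite_toSet.isCompact_convexHull (𝕜 := ℝ)

theorem IsPolytope.convex {P : Set (E n)} (hP : IsPolytope P) : Convex ℝ P := by
  obtain ⟨s, rfl⟩ := hP
  exact convex_convexHull ℝ _

theorem exists_centroid_add_smul_mem_face {P F : Set (E n)} (hP : IsPolytope P)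
    (hF : F ∈ faces P) {w : E n} (hw : w ∈ vectorSpan ℝ F) :
    ∃ ε : ℝ, 0 < ε ∧ centroid F + ε • w ∈ F :=
  exists_centroid_add_smul_mem (hF.2.isCompact hP.isCompact) (hF.2.convex hP.convex) hF.1 hw

theorem centroid_mem_face {P F : Set (E n)} (hP : IsPolytope P) (hF : F ∈ faces P) :
    centroid F ∈ F :=
  centroid_mem (hF.2.isCompact hP.isCompact) (hF.2.convex hP.convex) hF.1

theorem self_mem_faces {P : Set (E n)} (hP : P.Nonempty) : P ∈ faces P :=
  ⟨hP, IsExposed.refl P⟩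

theorem map_eq_zero_of_mem_vectorSpan {A : Set (E n)} {l : E n →L[ℝ] ℝ} {c : ℝ}
    (h : ∀ x ∈ A, l x = c) {w : E n} (hw : w ∈ vectorSpan ℝ A) : l w = 0 := by
  have : vectorSpan ℝ A ≤ LinearMap.ker l.toLinearMap := by
    rw [vectorSpan_def, Submodule.span_le]
    rintro _ ⟨x, hx, y, hy, rfl⟩
    simp [h x hx, h y hy]
  exact this hw

/-- A face is the set on which a functional attains its maximum over the polytope. -/
theorem exists_functional_of_mem_faces {P F : Set (E n)} (hF : F ∈ faces P) :
    ∃ (l : E n →L[ℝ] ℝ) (c : ℝ), (∀ x ∈ P, l x ≤ c) ∧ F = {x ∈ P | l x = c} := by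
  obtain ⟨l, hl⟩ := hF.2 hF.1
  obtain ⟨a, ha⟩ := hF.1
  have ha' : a ∈ P ∧ ∀ y ∈ P, l y ≤ l a := by rw [hl] at ha; exact ha
  refine ⟨l, l a, ha'.2, ?_⟩
  rw [hl]
  ext x
  refine ⟨fun hx => ⟨hx.1, le_antisymm (ha'.2 x hx.1) (hx.2 a ha'.1)⟩,
    fun hx => ⟨hx.1, fun y hy => ?_⟩⟩
  rw [hx.2]; exact ha'.2 y hy

theorem mem_faces_of_functional {P F : Set (E n)} (hF : F.Nonempty) (l : E n →L[ℝ] ℝ) (c : ℝ)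
    (hl : ∀ x ∈ P, l x ≤ c) (h : F = {x ∈ P | l x = c}) : F ∈ faces P := by
  refine ⟨hF, fun _ => ⟨l, ?_⟩⟩
  obtain ⟨a, ha⟩ := hF
  have ha' : a ∈ P ∧ l a = c := by rw [h] at ha; exact ha
  rw [h]
  ext x
  refine ⟨fun hx => ⟨hx.1, fun y hy => hx.2.symm ▸ hl y hy⟩, fun hx => ⟨hx.1, ?_⟩⟩
  exact le_antisymm (hl x hx.1) (ha'.2 ▸ hx.2 a ha'.1)

/-- A functional exposing `F` vanishes on its direction space; if that were everything, the
functional would be zero and expose all of `P`. -/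
theorem vectorSpan_ne_top_of_mem_properFaces {P F : Set (E n)} (hF : F ∈ properFaces P) :
    vectorSpan ℝ F ≠ ⊤ := by
  obtain ⟨l, c, hl, hFl⟩ := exists_functional_of_mem_faces hF.1
  intro htop
  have hl0 : ∀ w, l w = 0 := fun w => map_eq_zero_of_mem_vectorSpan (A := F) (c := c)
    (fun x hx => by rw [hFl] at hx; exact hx.2) (htop ▸ Submodule.mem_top)
  obtain ⟨a, ha⟩ := hF.1.1
  rw [hFl] at ha
  apply hF.2
  rw [hFl]
  ext x
  exact ⟨fun hx => hx.1, fun hx => ⟨hx, by rw [hl0, ← hl0 a, ha.2]⟩⟩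

/-! ### Projections of faces -/

theorem starProjection_eq (u : S n) (x : E n) :
    (ℝ ∙ (u : E n))ᗮ.starProjection x = x - inner ℝ (u : E n) x • (u : E n) := by
  rw [Submodule.starProjection_orthogonal_val,
    Submodule.starProjection_unit_singleton ℝ (by simp)]

theorem map_starProjection {u : S n} {l : E n →L[ℝ] ℝ} (hl : l u = 0) (x : E n) :
    l ((ℝ ∙ (u : E n))ᗮ.starProjection x) = l x := by
  rw [starProjection_eq]; simp [hl]

theorem starProjection_self (u : S n) : (ℝ ∙ (u : E n))ᗮ.starProjection (u : E n) = 0 := by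
  rw [starProjection_eq]; simp

/-- Distinct points in one fibre of the projection differ by a nonzero multiple of `u`. -/
theorem mem_vectorSpan_of_starProjection_eq {u : S n} {A : Set (E n)} {x y : E n} (hx : x ∈ A)
    (hy : y ∈ A) (hxy : x ≠ y)
    (h : (ℝ ∙ (u : E n))ᗮ.starProjection x = (ℝ ∙ (u : E n))ᗮ.starProjection y) :
    (u : E n) ∈ vectorSpan ℝ A := by
  rw [starProjection_eq, starProjection_eq] at h
  set s := inner ℝ (u : E n) x
  set t := inner ℝ (u : E n) y
  have hd : x - y = (s - t) • (u : E n) := by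
    rw [sub_smul, sub_eq_sub_iff_sub_eq_sub]
    exact h
  have hst : s - t ≠ 0 := by
    intro h0
    rw [h0, zero_smul, sub_eq_zero] at hd
    exact hxy hd
  have hmem : x - y ∈ vectorSpan ℝ A := vsub_mem_vectorSpan ℝ hx hy
  rw [hd] at hmem
  exact (Submodule.smul_mem_iff _ hst).1 hmem

theorem injOn_starProjection {u : S n} {A : Set (E n)} (hu : (u : E n) ∉ vectorSpan ℝ A) :
    Set.InjOn (ℝ ∙ (u : E n))ᗮ.starProjection A := fun _ hx _ hy h => by
  by_contra hne
  exact hu (mem_vectorSpan_of_starProjection_eq hx hy hne h)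

theorem vectorSpan_proj (u : S n) (A : Set (E n)) :
    vectorSpan ℝ (proj u A) =
      (vectorSpan ℝ A).map (ℝ ∙ (u : E n))ᗮ.starProjection.toLinearMap :=
  (AffineMap.map_vectorSpan (ℝ ∙ (u : E n))ᗮ.starProjection.toLinearMap.toAffineMap
    (s := A)).symm

theorem dim_proj {u : S n} {A : Set (E n)} (hu : (u : E n) ∉ vectorSpan ℝ A) :
    dim (proj u A) = dim A := by
  rw [dim, dim, vectorSpan_proj]
  set f := (ℝ ∙ (u : E n))ᗮ.starProjection.toLinearMap
  have hinj : Function.Injective (f.domRestrict (vectorSpan ℝ A)) := by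
    intro x y hxy
    by_contra hne
    -- The fibre lemma is applied to the direction space itself, viewed as a set.
    have h := mem_vectorSpan_of_starProjection_eq (u := u) (A := (vectorSpan ℝ A : Set (E n)))
      x.2 y.2 (fun h => hne (Subtype.ext h)) hxy
    refine hu ?_
    have hle : vectorSpan ℝ (vectorSpan ℝ A : Set (E n)) ≤ vectorSpan ℝ A := by
      rw [vectorSpan_def, Submodule.span_le]
      rintro _ ⟨x, hx, y, hy, rfl⟩
      exact Submodule.sub_mem _ hx hy
    exact hle h
  rw [← LinearMap.range_domRestrict]
  exact LinearMap.finrank_range_of_inj hinj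

theorem dim_proj_of_vectorSpan_eq_top {A : Set (E n)} (hA : vectorSpan ℝ A = ⊤) (u : S n) :
    dim (proj u A) + 1 = n := by
  have hr : vectorSpan ℝ (proj u A) = (ℝ ∙ (u : E n))ᗮ := by
    rw [vectorSpan_proj, hA, Submodule.map_top]
    exact Submodule.range_starProjection _
  have h1 := Submodule.finrank_add_finrank_orthogonal (ℝ ∙ (u : E n))
  rw [finrank_span_singleton (by simpa using ne_zero_of_mem_unit_sphere u),
    finrank_euclideanSpace_fin] at h1
  rw [dim, hr]
  omega

/-- The part of `P` which projects into `G`. -/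
def lift (u : S n) (P G : Set (E n)) : Set (E n) :=
  {x ∈ P | (ℝ ∙ (u : E n))ᗮ.starProjection x ∈ G}

theorem proj_lift {u : S n} {P G : Set (E n)} (hG : G ⊆ proj u P) : proj u (lift u P G) = G := by
  ext y
  constructor
  · rintro ⟨x, hx, rfl⟩
    exact hx.2
  · intro hy
    obtain ⟨x, hx, rfl⟩ := hG hy
    exact ⟨x, ⟨hx, hy⟩, rfl⟩

/-- A functional exposing `G`, composed with the projection, exposes the part of `P` above `G`. -/
theorem lift_mem_properFaces {u : S n} {P G : Set (E n)} (hG : G ∈ properFaces (proj u P)) :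
    lift u P G ∈ properFaces P := by
  obtain ⟨l, c, hl, hGl⟩ := exists_functional_of_mem_faces hG.1
  have hsub : G ⊆ proj u P := hG.1.2.subset
  refine ⟨mem_faces_of_functional ?_ (l.comp (ℝ ∙ (u : E n))ᗮ.starProjection) c
    (fun x hx => hl _ ⟨x, hx, rfl⟩) ?_, ?_⟩
  · have := hG.1.1
    rw [← proj_lift hsub] at this
    exact this.of_image
  · ext x
    simp only [lift, Set.mem_ofPred_eq]
    refine and_congr_right fun hx => ?_
    rw [hGl]
    exact ⟨fun h => h.2, fun h => ⟨⟨x, hx, rfl⟩, h⟩⟩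
  · intro h
    apply hG.2
    conv_lhs => rw [← proj_lift hsub, h]

theorem subset_lift {u : S n} {P F : Set (E n)} (hF : F ⊆ P) : F ⊆ lift u P (proj u F) :=
  fun x hx => ⟨hF hx, ⟨x, hx, rfl⟩⟩

/-- The projection is injective on the preimage of `F_u`, so nothing besides `F` lies above `F_u`.
-/
theorem eq_lift {u : S n} {P F : Set (E n)} (hF : F ⊆ P)
    (hu : (u : E n) ∉ vectorSpan ℝ (lift u P (proj u F))) : F = lift u P (proj u F) := by
  refine (subset_lift hF).antisymm fun x hx => ?_
  obtain ⟨y, hy, hyx⟩ := hx.2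
  rwa [← injOn_starProjection hu (subset_lift hF hy) hx hyx]

/-- If neither `u` nor `-u` points from the centroid of `F` into `P`, then the projection along
`u` preserves the face `F`. -/
theorem proj_mem_properFaces {P F : Set (E n)} (hP : IsPolytope P) (hF : F ∈ properFaces P)
    {u : S n} (hu : u ∉ innerAngle P (centroid F)) (hu' : -u ∉ innerAngle P (centroid F)) :
    proj u F ∈ properFaces (proj u P) := by
  classical
  obtain ⟨f, b, hf, hFf⟩ := exists_functional_of_mem_faces hF.1
  have hv := centroid_mem_face hP hF.1
  have hrel := fun w => exists_centroid_add_smul_mem_face hP hF.1 (w := w)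
  have hPc := hP.convex
  set v := centroid F
  have hfF : ∀ x ∈ F, f x = b := fun x hx => by rw [hFf] at hx; exact hx.2
  have hFP : F ⊆ P := hF.1.2.subset
  obtain ⟨s, hs⟩ := hP
  -- The generators off `F`. They are to be separated from the flat `M` through `v` with directions
  -- `W`.
  set s' : Set (E n) := {x ∈ (s : Set (E n)) | f x < b}
  have hsP : (s : Set (E n)) ⊆ P := hs ▸ subset_convexHull ℝ _
  have hs'fin : s'.Finite := s.finite_toSet.subset (Set.sep_subset _ _)
  have hs'P : convexHull ℝ s' ⊆ P := convexHull_min ((Set.sep_subset _ _).trans hsP) hPc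
  have hs'b : ∀ x ∈ convexHull ℝ s', f x < b := by
    have : convexHull ℝ s' ⊆ {x | f x < b} :=
      convexHull_min (fun x hx => hx.2) (convex_halfSpace_lt f.isLinear b)
    exact fun x hx => this hx
  set W : Submodule ℝ (E n) := vectorSpan ℝ F ⊔ ℝ ∙ (u : E n)
  let M : Set (E n) := (fun x => x - v) ⁻¹' (W : Set (E n))
  have hMc : Convex ℝ M := by
    have := W.convex.translate_preimage_left (-v)
    simpa [M, sub_eq_add_neg] using this
  have hMcl : IsClosed M := W.closed_of_finiteDimensional.preimage (by fun_prop)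
  have hdisj : Disjoint (convexHull ℝ s') M := by
    rw [Set.disjoint_left]
    intro p hp hpM
    obtain ⟨w, hw, z, hz, hwz⟩ := Submodule.mem_sup.1 hpM
    obtain ⟨t, rfl⟩ := Submodule.mem_span_singleton.1 hz
    have hpe : p = v + (w + t • (u : E n)) := by rw [hwz]; exact (add_sub_cancel v p).symm
    have ht : t ≠ 0 := by
      rintro rfl
      have h1 := hs'b p hp
      rw [hpe] at h1
      simp [hfF v hv, map_eq_zero_of_mem_vectorSpan hfF hw] at h1
    -- As `v` is relatively interior to `F`, `v - εw` lies in `F`. Weights `1/(1+ε)` and `ε/(1+ε)`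
    -- on it and `p` cancel `w`, leaving a point of `P` on the line through `v` along `u`.
    obtain ⟨ε, hε, hεF⟩ := hrel (-w) (Submodule.neg_mem _ hw)
    have hε1 : (1 : ℝ) + ε ≠ 0 := by positivity
    have hcomb : v + (ε * t / (1 + ε)) • (u : E n) ∈ P := by
      have := hPc (hFP hεF) (hs'P hp) (a := 1 / (1 + ε)) (b := ε / (1 + ε)) (by positivity)
        (by positivity) (by field_simp)
      convert this using 1
      rw [hpe]
      have e1 : v = (1 / (1 + ε) + ε / (1 + ε)) • v := by
        rw [← add_div, div_self hε1, one_smul]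
      conv_lhs => rw [e1]
      module
    rcases lt_or_gt_of_ne ht with h | h
    · refine hu' ⟨-(ε * t / (1 + ε)), ?_, ?_⟩
      · rw [neg_pos]; exact div_neg_of_neg_of_pos (mul_neg_of_pos_of_neg hε h) (by positivity)
      · simpa using hcomb
    · exact hu ⟨ε * t / (1 + ε), by positivity, hcomb⟩
  obtain ⟨l, a, a', hla, haa', hlM⟩ := geometric_hahn_banach_compact_closed
    (convex_convexHull ℝ s') (hs'fin.isCompact_convexHull (𝕜 := ℝ)) hMc hMcl hdisj
  -- `l` is bounded below on `M`, so it cannot vary along `W`: the chosen multiple of `w` would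
  -- bring its value down to `a'` exactly.
  have hlW : ∀ w ∈ W, l w = 0 := by
    intro w hw
    by_contra hne
    have h1 := hlM (v + ((a' - l v) / l w) • w) (by
      simp only [M, Set.mem_preimage, add_sub_cancel_left]; exact W.smul_mem _ hw)
    simp only [map_add, map_smul, smul_eq_mul] at h1
    rw [div_mul_cancel₀ _ hne] at h1
    linarith
  have hlu : l u = 0 := hlW _ (Submodule.mem_sup_right (Submodule.mem_span_singleton_self _))
  have hlF : ∀ x ∈ F, l x = l v := fun x hx => by
    have h1 := hlW (x - v) (Submodule.mem_sup_left (vsub_mem_vectorSpan ℝ hx hv))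
    rw [map_sub, sub_eq_zero] at h1
    exact h1
  have hlv : ∀ x ∈ convexHull ℝ s', l x < l v := fun x hx =>
    (hla x hx).trans (haa'.trans (hlM v (by simp [M])))
  have hsF : ∀ x ∈ (s : Set (E n)), x ∈ F ∨ x ∈ s' := fun x hx => by
    rcases (hf x (hsP hx)).lt_or_eq with h | h
    · exact Or.inr ⟨hx, h⟩
    · left; rw [hFf]; exact ⟨hsP hx, h⟩
  have hlP : ∀ x ∈ P, l x ≤ l v ∧ (l x = l v → x ∈ F) := by
    have hne : s'.Nonempty := by
      by_contra hemp
      rw [Set.not_nonempty_iff_eq_empty] at hemp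
      apply hF.2
      refine hFP.antisymm ?_
      rw [hs]
      refine convexHull_min (fun x hx => ?_) (hF.1.2.convex hPc)
      rcases hsF x hx with h | h
      · exact h
      · rw [hemp] at h; exact h.elim
    -- Each point of `P` mixes a point of `F`, where `l` equals `l v`, with one where `l` is
    -- smaller; equality forces the second weight to vanish.
    have hsub : P ⊆ convexJoin ℝ F (convexHull ℝ s') := by
      rw [hs]
      have h1 : (s : Set (E n)) ⊆ F ∪ s' := fun x hx => hsF x hx
      refine (convexHull_mono h1).trans ?_
      rw [convexHull_union hF.1.1 hne, (hF.1.2.convex hPc).convexHull_eq]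
    intro x hx
    obtain ⟨y, hy, z, hz, hxyz⟩ := mem_convexJoin.1 (hsub hx)
    obtain ⟨α, β, hα, hβ, hαβ, rfl⟩ := hxyz
    have h1 := hlF y hy
    have h2 := hlv z hz
    have h3 : l (α • y + β • z) = l v + β * (l z - l v) := by
      simp only [map_add, map_smul, smul_eq_mul, h1]
      linear_combination (l v) * hαβ
    rw [h3]
    refine ⟨by nlinarith, fun h => ?_⟩
    have hβ0 : β = 0 := by
      have : β * (l z - l v) = 0 := by linarith
      exact (mul_eq_zero.1 this).resolve_right (by linarith)
    subst hβ0
    have hα1 : α = 1 := by linarith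
    subst hα1
    simpa using hy
  refine ⟨mem_faces_of_functional (hF.1.1.image _) l (l v) ?_ ?_, ?_⟩
  · rintro _ ⟨x, hx, rfl⟩
    rw [map_starProjection hlu]
    exact (hlP x hx).1
  · ext y
    constructor
    · rintro ⟨x, hx, rfl⟩
      exact ⟨⟨x, hFP hx, rfl⟩, by rw [map_starProjection hlu, hlF x hx]⟩
    · rintro ⟨⟨x, hx, rfl⟩, h⟩
      rw [map_starProjection hlu] at h
      exact ⟨x, (hlP x hx).2 h, rfl⟩
  · intro h
    apply hF.2
    refine hFP.antisymm fun x hx => ?_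
    have : (ℝ ∙ (u : E n))ᗮ.starProjection x ∈ proj u F := h ▸ ⟨x, hx, rfl⟩
    obtain ⟨y, hy, hyx⟩ := this
    refine (hlP x hx).2 ?_
    rw [← map_starProjection hlu x, ← hyx, map_starProjection hlu, hlF y hy]

/-- If a nonzero multiple of `u` points from the centroid of `F` into `P`, then `u` is parallel to
the part of `P` lying over the projection of `F`. -/
theorem mem_vectorSpan_lift_of_mem_innerAngle {P F : Set (E n)} (hP : IsPolytope P)
    (hF : F ∈ faces P) {u : S n} {σ : ℝ} (hσ : σ ≠ 0)
    (hu : centroid F + σ • (u : E n) ∈ P) :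
    (u : E n) ∈ vectorSpan ℝ (lift u P (proj u F)) := by
  have hv := centroid_mem_face hP hF
  have h1 : (ℝ ∙ (u : E n))ᗮ.starProjection (centroid F + σ • (u : E n)) =
      (ℝ ∙ (u : E n))ᗮ.starProjection (centroid F) := by
    rw [map_add, map_smul, starProjection_self]; simp
  refine mem_vectorSpan_of_starProjection_eq (x := centroid F + σ • (u : E n)) (y := centroid F)
    ⟨hu, ?_⟩ (subset_lift hF.2.subset hv) ?_ h1
  · rw [h1]; exact ⟨_, hv, rfl⟩
  · simpa [hσ] using ne_zero_of_mem_unit_sphere u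

/-! ### The uniform measure on the sphere -/

theorem surfaceMeasure_univ_eq (n : ℕ) :
    surfaceMeasure n Set.univ = n * volume (Metric.ball (0 : E n) 1) := by
  rw [surfaceMeasure, Measure.toSphere_apply_univ, finrank_euclideanSpace_fin]

theorem surfaceMeasure_real_univ (hn : 0 < n) :
    (surfaceMeasure n).real Set.univ = n * ω n := by
  have : Nonempty (Fin n) := ⟨⟨0, hn⟩⟩
  have hG : 0 < Real.Gamma ((n : ℝ) / 2 + 1) := Real.Gamma_pos_of_pos (by positivity)
  rw [Measure.real, surfaceMeasure_univ_eq, EuclideanSpace.volume_ball, Fintype.card_fin,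
    ENNReal.ofReal_one, one_pow, one_mul, ENNReal.toReal_mul, ENNReal.toReal_natCast,
    ENNReal.toReal_ofReal (by positivity), ω, add_comm (1 : ℝ), Real.sqrt_eq_rpow,
    ← Real.rpow_natCast, ← Real.rpow_mul Real.pi_pos.le]
  rw [one_div_mul_eq_div]

instance isFiniteMeasure_surfaceMeasure (n : ℕ) : IsFiniteMeasure (surfaceMeasure n) :=
  inferInstanceAs (IsFiniteMeasure (volume : Measure (E n)).toSphere)

theorem surfaceMeasure_univ_ne_zero (hn : 0 < n) : surfaceMeasure n Set.univ ≠ 0 := by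
  rw [surfaceMeasure_univ_eq]
  exact mul_ne_zero (by exact_mod_cast hn.ne')
    (Metric.measure_ball_pos volume _ one_pos).ne'

theorem isProbabilityMeasure_uniformSphere (hn : 0 < n) :
    IsProbabilityMeasure (uniformSphere n) :=
  ⟨by rw [uniformSphere, Measure.smul_apply, smul_eq_mul,
    ENNReal.inv_mul_cancel (surfaceMeasure_univ_ne_zero hn) (measure_ne_top _ _)]⟩

theorem uniformSphere_real (hn : 0 < n) (A : Set (S n)) :
    (uniformSphere n).real A = (surfaceMeasure n).real A / (n * ω n) := by
  rw [← surfaceMeasure_real_univ hn, uniformSphere, measureReal_ennreal_smul_apply,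
    ENNReal.toReal_inv, inv_mul_eq_div]
  rfl

/-- Surface measure is a multiple of the volume of the cone over a set, and the cone over these
directions stays in the null subspace `W`. -/
theorem surfaceMeasure_submodule {W : Submodule ℝ (E n)} (hW : W ≠ ⊤) :
    surfaceMeasure n {u | (u : E n) ∈ W} = 0 := by
  have hm : MeasurableSet {u : S n | (u : E n) ∈ W} :=
    (W.closed_of_finiteDimensional.preimage continuous_subtype_val).measurableSet
  rw [surfaceMeasure, Measure.toSphere_apply' _ hm, mul_eq_zero]
  right
  refine measure_mono_null ?_ (Measure.addHaar_submodule volume W hW)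
  rintro _ ⟨r, -, _, ⟨u, hu, rfl⟩, rfl⟩
  exact W.smul_mem r hu

theorem ae_notMem_submodule {W : Submodule ℝ (E n)} (hW : W ≠ ⊤) :
    ∀ᵐ u : S n ∂surfaceMeasure n, (u : E n) ∉ W := by
  rw [ae_iff]
  simpa using surfaceMeasure_submodule hW

theorem uniformSphere_ae {p : S n → Prop} (h : ∀ᵐ u ∂surfaceMeasure n, p u) :
    ∀ᵐ u ∂uniformSphere n, p u :=
  Measure.ae_smul_measure h _

theorem surfaceMeasure_neg {A : Set (S n)} (hA : MeasurableSet A) :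
    surfaceMeasure n {u | -u ∈ A} = surfaceMeasure n A := by
  have hA' : MeasurableSet {u : S n | -u ∈ A} :=
    hA.preimage (by fun_prop : Continuous fun u : S n => -u).measurable
  rw [surfaceMeasure, Measure.toSphere_apply' _ hA, Measure.toSphere_apply' _ hA',
    ← Measure.measure_neg]
  congr 2
  ext x
  simp only [Set.mem_neg, Set.mem_smul, Set.mem_image, Set.mem_ofPred_eq]
  constructor
  · rintro ⟨r, hr, _, ⟨u, hu, rfl⟩, h⟩
    exact ⟨r, hr, _, ⟨-u, hu, rfl⟩, by simp [h]⟩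
  · rintro ⟨r, hr, _, ⟨u, hu, rfl⟩, h⟩
    exact ⟨r, hr, _, ⟨-u, by simpa using hu, rfl⟩, by simp [h]⟩

/-! ### Inner angles -/

/-- By convexity an admissible `ε` may be shrunk, so the steps `1/(m+1)` suffice and the angle is a
countable union of closed sets. -/
theorem measurableSet_innerAngle {P : Set (E n)} (hP : IsPolytope P) {v : E n} (hv : v ∈ P) :
    MeasurableSet (innerAngle P v) := by
  have h : innerAngle P v = ⋃ m : ℕ, {u : S n | v + ((m : ℝ) + 1)⁻¹ • (u : E n) ∈ P} := by
    ext u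
    simp only [innerAngle, Set.mem_ofPred_eq, Set.mem_iUnion]
    constructor
    · rintro ⟨ε, hε, h⟩
      obtain ⟨m, hm⟩ := exists_nat_one_div_lt hε
      refine ⟨m, ?_⟩
      rw [one_div] at hm
      have hpos : (0 : ℝ) < ((m : ℝ) + 1)⁻¹ := by positivity
      have := hP.convex.add_smul_mem hv h (t := ((m : ℝ) + 1)⁻¹ / ε)
        ⟨by positivity, (div_le_one hε).2 hm.le⟩
      rwa [smul_smul, div_mul_cancel₀ _ hε.ne'] at this
    · rintro ⟨m, hm⟩
      exact ⟨_, by positivity, hm⟩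
  rw [h]
  refine MeasurableSet.iUnion fun m => ?_
  exact (hP.isCompact.isClosed.preimage
    (by fun_prop : Continuous fun u : S n => v + ((m : ℝ) + 1)⁻¹ • (u : E n))).measurableSet

theorem mem_vectorSpan_of_mem_innerAngle {P : Set (E n)} {v : E n} (hv : v ∈ P) {u : S n}
    (hu : u ∈ innerAngle P v) : (u : E n) ∈ vectorSpan ℝ P := by
  obtain ⟨ε, hε, h⟩ := hu
  have := vsub_mem_vectorSpan ℝ h hv
  rw [vsub_eq_sub, add_sub_cancel_left] at this
  exact (Submodule.smul_mem_iff _ hε.ne').1 this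

theorem α_self {P : Set (E n)} (hP : IsPolytope P) (hne : P.Nonempty)
    (hd : vectorSpan ℝ P ≠ ⊤) : α P P = 0 := by
  have h : surfaceMeasure n (innerAngle P (centroid P)) = 0 :=
    measure_mono_null (fun u hu => mem_vectorSpan_of_mem_innerAngle
      (centroid_mem_face hP (self_mem_faces hne)) hu) (surfaceMeasure_submodule hd)
  rw [α, Measure.real, h, ENNReal.toReal_zero]

/-- A functional exposing `F` can increase along neither `u` nor `-u`, so it vanishes on `u` and the
displaced centroid remains in `F`. -/
theorem mem_vectorSpan_of_mem_innerAngle_of_neg_mem {P F : Set (E n)} (hP : IsPolytope P)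
    (hF : F ∈ faces P) {u : S n} (hu : u ∈ innerAngle P (centroid F))
    (hu' : -u ∈ innerAngle P (centroid F)) : (u : E n) ∈ vectorSpan ℝ F := by
  have hv := centroid_mem_face hP hF
  obtain ⟨l, c, hl, hFl⟩ := exists_functional_of_mem_faces hF
  obtain ⟨ε, hε, h⟩ := hu
  obtain ⟨δ, hδ, h'⟩ := hu'
  have hvc : l (centroid F) = c := by rw [hFl] at hv; rw [hFl]; exact hv.2
  have h1 := hl _ h
  have h2 := hl _ h'
  simp only [map_add, map_smul, smul_eq_mul, hvc, Metric.sphere, coe_neg_sphere, map_neg] at h1 h2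
  have hlu : l u = 0 := by
    refine le_antisymm ?_ ?_
    · by_contra! hc; nlinarith [mul_pos hε hc]
    · by_contra! hc; nlinarith [mul_pos hδ (neg_pos.2 hc)]
  have hmem : centroid F + ε • (u : E n) ∈ F := by
    have : l (centroid F + ε • (u : E n)) = c := by simp [hlu, hvc]
    exact hFl.symm.subset ⟨h, this⟩
  exact mem_vectorSpan_of_mem_innerAngle hv ⟨ε, hε, hmem⟩

/-! ### Generic directions -/

/-- Almost every direction is not parallel to any proper face. -/
theorem ae_generic {P : Set (E n)} (hP : IsPolytope P) :
    ∀ᵐ u : S n ∂surfaceMeasure n, ∀ F ∈ properFaces P, (u : E n) ∉ vectorSpan ℝ F := by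
  have hfin : (properFaces P).Finite := hP.finite_faces.subset fun F hF => hF.1
  exact (ae_ball_iff hfin.countable).2 fun F hF =>
    ae_notMem_submodule (vectorSpan_ne_top_of_mem_properFaces hF)

theorem proj_mem_properFaces_iff {P F : Set (E n)} (hP : IsPolytope P) (hF : F ∈ properFaces P)
    {u : S n} (hu : ∀ G ∈ properFaces P, (u : E n) ∉ vectorSpan ℝ G) :
    proj u F ∈ properFaces (proj u P) ↔
      u ∉ innerAngle P (centroid F) ∧ -u ∉ innerAngle P (centroid F) := by
  refine ⟨fun h => ⟨?_, ?_⟩, fun h => proj_mem_properFaces hP hF h.1 h.2⟩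
  · rintro ⟨ε, hε, hm⟩
    exact hu _ (lift_mem_properFaces h)
      (mem_vectorSpan_lift_of_mem_innerAngle hP hF.1 hε.ne' hm)
  · rintro ⟨ε, hε, hm⟩
    refine hu _ (lift_mem_properFaces h)
      (mem_vectorSpan_lift_of_mem_innerAngle hP hF.1 (neg_ne_zero.2 hε.ne') (σ := -ε) ?_)
    simpa using hm

theorem proj_event_ae_eq {P F : Set (E n)} (hP : IsPolytope P) (hF : F ∈ properFaces P) :
    ({u | proj u F ∈ properFaces (proj u P)} : Set (S n)) =ᵐ[surfaceMeasure n]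
      ((innerAngle P (centroid F) ∪ {u | -u ∈ innerAngle P (centroid F)})ᶜ : Set (S n)) := by
  refine Filter.eventuallyEq_set.2 ?_
  filter_upwards [ae_generic hP] with u hu
  simp [proj_mem_properFaces_iff hP hF hu]

theorem measurableSet_neg_innerAngle {P F : Set (E n)} (hP : IsPolytope P)
    (hF : F ∈ faces P) : MeasurableSet {u | -u ∈ innerAngle P (centroid F)} :=
  (measurableSet_innerAngle hP (hF.2.subset (centroid_mem_face hP hF))).preimage
    (by fun_prop : Continuous fun u : S n => -u).measurable

theorem nullMeasurableSet_proj_event {P F : Set (E n)} (hP : IsPolytope P)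
    (hF : F ∈ properFaces P) :
    NullMeasurableSet {u | proj u F ∈ properFaces (proj u P)} (uniformSphere n) := by
  have hm : MeasurableSet (innerAngle P (centroid F) ∪ {u | -u ∈ innerAngle P (centroid F)})ᶜ :=
    ((measurableSet_innerAngle hP (hF.1.2.subset (centroid_mem_face hP hF.1))).union
      (measurableSet_neg_innerAngle hP hF.1)).compl
  exact hm.nullMeasurableSet.congr
    (Filter.eventuallyEq_set.2
      (uniformSphere_ae (Filter.eventuallyEq_set.1 (proj_event_ae_eq hP hF).symm)))

theorem uniformSphere_real_proj_event (hn : 0 < n) {P F : Set (E n)} (hP : IsPolytope P)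
    (hF : F ∈ properFaces P) :
    (uniformSphere n).real {u | proj u F ∈ properFaces (proj u P)} =
      1 - 2 * α P F / (n * ω n) := by
  have hA := measurableSet_innerAngle hP (hF.1.2.subset (centroid_mem_face hP hF.1))
  have hA' := measurableSet_neg_innerAngle hP hF.1
  have hpos : (n : ℝ) * ω n ≠ 0 := by
    rw [← surfaceMeasure_real_univ hn, Measure.real]
    exact (ENNReal.toReal_pos (surfaceMeasure_univ_ne_zero hn) (measure_ne_top _ _)).ne'
  have hinter : AEDisjoint (surfaceMeasure n) (innerAngle P (centroid F))
      {u | -u ∈ innerAngle P (centroid F)} :=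
    measure_mono_null (fun u hu => mem_vectorSpan_of_mem_innerAngle_of_neg_mem hP hF.1 hu.1 hu.2)
      (surfaceMeasure_submodule (vectorSpan_ne_top_of_mem_properFaces hF))
  have hneg : (surfaceMeasure n).real {u | -u ∈ innerAngle P (centroid F)} = α P F := by
    rw [Measure.real, surfaceMeasure_neg hA]; rfl
  rw [uniformSphere_real hn, measureReal_congr (proj_event_ae_eq hP hF),
    measureReal_compl (hA.union hA'), measureReal_union₀ hA'.nullMeasurableSet hinter,
    hneg, surfaceMeasure_real_univ hn]
  change (n * ω n - (α P F + α P F)) / (n * ω n) = _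
  rw [sub_div, div_self hpos, two_mul]

/-! ### Counting faces -/

theorem IsPolytope.finite_properKFaces {P : Set (E n)} (hP : IsPolytope P) (k : ℕ) :
    (properKFaces k P).Finite :=
  hP.finite_faces.subset fun _ hF => hF.1.1

theorem IsPolytope.finite_kFaces {P : Set (E n)} (hP : IsPolytope P) (k : ℕ) :
    (kFaces k P).Finite :=
  hP.finite_faces.subset fun _ hF => hF.1

theorem IsPolytope.proj {P : Set (E n)} (hP : IsPolytope P) (u : S n) :
    IsPolytope (proj u P) := by
  classical
  obtain ⟨s, rfl⟩ := hP
  refine ⟨s.image (ℝ ∙ (u : E n))ᗮ.starProjection, ?_⟩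
  rw [Finset.coe_image]
  exact (ℝ ∙ (u : E n))ᗮ.starProjection.toLinearMap.image_convexHull _

/-- For a generic direction, the proper `k`-faces of the projection correspond to those proper
`k`-faces whose projection is a proper face. -/
theorem ncard_properKFaces_proj {P : Set (E n)} {u : S n}
    (hu : ∀ G ∈ properFaces P, (u : E n) ∉ vectorSpan ℝ G) (k : ℕ) :
    (properKFaces k (proj u P)).ncard =
      {F ∈ properKFaces k P | proj u F ∈ properFaces (proj u P)}.ncard := by
  have himg : properKFaces k (proj u P) =
      proj u '' {F ∈ properKFaces k P | proj u F ∈ properFaces (proj u P)} := by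
    ext G
    constructor
    · rintro ⟨hG, hd⟩
      have hL := lift_mem_properFaces hG
      have hpl := proj_lift hG.1.2.subset
      refine ⟨lift u P G, ⟨⟨hL, ?_⟩, by rwa [hpl]⟩, hpl⟩
      rw [← dim_proj (hu _ hL), hpl, hd]
    · rintro ⟨F, ⟨hF, hFu⟩, rfl⟩
      exact ⟨hFu, by rw [dim_proj (hu _ hF.1), hF.2]⟩
  rw [himg]
  -- Each surviving face is recovered from its projection as the preimage in `P`.
  refine Set.InjOn.ncard_image fun F hF F' hF' h => ?_
  have h1 := eq_lift hF.1.1.1.2.subset (hu _ (lift_mem_properFaces hF.2))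
  have h2 := eq_lift hF'.1.1.1.2.subset (hu _ (lift_mem_properFaces hF'.2))
  rw [h1, h2, h]

theorem ncard_properKFaces_proj_ae {P : Set (E n)} (hP : IsPolytope P) (k : ℕ) :
    (fun u => ((properKFaces k (proj u P)).ncard : ℝ)) =ᵐ[uniformSphere n]
      fun u => ∑ F ∈ (hP.finite_properKFaces k).toFinset,
        {u | proj u F ∈ properFaces (proj u P)}.indicator (fun _ => (1 : ℝ)) u := by
  classical
  filter_upwards [uniformSphere_ae (ae_generic hP)] with u hu
  rw [ncard_properKFaces_proj hu k]
  have : {F ∈ properKFaces k P | proj u F ∈ properFaces (proj u P)} =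
      ((hP.finite_properKFaces k).toFinset.filter
        fun F => proj u F ∈ properFaces (proj u P) : Finset (Set (E n))) := by
    ext F; simp
  rw [this, Set.ncard_coe_finset, Finset.card_filter, Nat.cast_sum]
  refine Finset.sum_congr rfl fun F _ => ?_
  simp [Set.indicator_apply]

theorem integrable_proj_event (hn : 0 < n) {P F : Set (E n)} (hP : IsPolytope P)
    (hF : F ∈ properFaces P) :
    Integrable ({u | proj u F ∈ properFaces (proj u P)}.indicator (fun _ => (1 : ℝ)))
      (uniformSphere n) := by
  have := isProbabilityMeasure_uniformSphere hn
  exact (integrable_const (1 : ℝ)).indicator₀ (nullMeasurableSet_proj_event hP hF)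

theorem integrable_ncard_properKFaces (hn : 0 < n) {P : Set (E n)} (hP : IsPolytope P) (k : ℕ) :
    Integrable (fun u => ((properKFaces k (proj u P)).ncard : ℝ)) (uniformSphere n) := by
  refine (integrable_finsetSum _ fun F hF => ?_).congr (ncard_properKFaces_proj_ae hP k).symm
  exact integrable_proj_event hn hP ((hP.finite_properKFaces k).mem_toFinset.1 hF).1

theorem integral_ncard_properKFaces (hn : 0 < n) {P : Set (E n)} (hP : IsPolytope P) (k : ℕ) :
    ∫ u, ((properKFaces k (proj u P)).ncard : ℝ) ∂uniformSphere n =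
      ∑ᶠ F ∈ properKFaces k P, (1 - 2 * α P F / (n * ω n)) := by
  have := isProbabilityMeasure_uniformSphere hn
  rw [integral_congr_ae (ncard_properKFaces_proj_ae hP k), integral_finsetSum _ fun F hF =>
    integrable_proj_event hn hP ((hP.finite_properKFaces k).mem_toFinset.1 hF).1,
    finsum_mem_eq_finite_toFinset_sum _ (hP.finite_properKFaces k)]
  refine Finset.sum_congr rfl fun F hF => ?_
  have hF' := ((hP.finite_properKFaces k).mem_toFinset.1 hF).1
  rw [integral_indicator₀ (nullMeasurableSet_proj_event hP hF'), setIntegral_const,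
    uniformSphere_real_proj_event hn hP hF', smul_eq_mul, mul_one]

theorem finsum_mem_one_sub {ι : Type*} {s : Set ι} (hs : s.Finite) (a : ι → ℝ) (c : ℝ) :
    ∑ᶠ i ∈ s, (1 - 2 * a i / c) = (s.ncard : ℝ) - 2 / c * ∑ᶠ i ∈ s, a i := by
  rw [finsum_mem_eq_finite_toFinset_sum _ hs, finsum_mem_eq_finite_toFinset_sum _ hs,
    Finset.sum_sub_distrib, Finset.mul_sum, Set.ncard_eq_toFinset_card s hs]
  simp only [Finset.sum_const, nsmul_eq_mul, mul_one]
  congr 1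
  exact Finset.sum_congr rfl fun i _ => by ring

theorem kFaces_eq_insert {P : Set (E n)} {k : ℕ} (hne : P.Nonempty) (hd : dim P = k) :
    kFaces k P = insert P (properKFaces k P) := by
  ext F
  simp only [kFaces, properKFaces, properFaces, Set.mem_ofPred_eq, Set.mem_insert_iff]
  constructor
  · rintro ⟨h, h'⟩
    by_cases hF : F = P
    · exact Or.inl hF
    · exact Or.inr ⟨⟨h, hF⟩, h'⟩
  · rintro (rfl | h)
    · exact ⟨self_mem_faces hne, hd⟩
    · exact ⟨h.1.1, h.2⟩

theorem self_notMem_properKFaces (P : Set (E n)) (k : ℕ) : P ∉ properKFaces k P :=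
  fun h => h.1.2 rfl

/-- The empty set is listed separately because its `dim` is 0, yet it is not one of its own nonempty
faces. -/
theorem kFaces_eq_properKFaces {P : Set (E n)} {k : ℕ} (h : P = ∅ ∨ dim P ≠ k) :
    kFaces k P = properKFaces k P := by
  refine Set.Subset.antisymm (fun F hF => ⟨⟨hF.1, ?_⟩, hF.2⟩) fun F hF => ⟨hF.1.1, hF.2⟩
  rintro rfl
  rcases h with rfl | h
  · exact Set.not_nonempty_empty hF.1.1
  · exact h hF.2

theorem dim_lt_iff {P : Set (E n)} : dim P < n ↔ vectorSpan ℝ P ≠ ⊤ := by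
  have hle := Submodule.finrank_le (vectorSpan ℝ P)
  rw [finrank_euclideanSpace_fin] at hle
  constructor
  · rintro h htop
    rw [dim, htop, finrank_top, finrank_euclideanSpace_fin] at h
    exact h.false
  · intro h
    refine lt_of_le_of_ne hle fun heq => h (Submodule.eq_top_of_finrank_eq ?_)
    rw [finrank_euclideanSpace_fin]; exact heq

theorem dim_proj_ae_of_lt {P : Set (E n)} (hd : dim P < n) :
    ∀ᵐ u ∂uniformSphere n, dim (proj u P) = dim P := by
  filter_upwards [uniformSphere_ae (ae_notMem_submodule (dim_lt_iff.1 hd))] with u hu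
  exact dim_proj hu

theorem kFaces_expectation (hn : 0 < n) {P : Set (E n)} (hP : IsPolytope P) {k : ℕ} (hk : k < n)
    (hkd : k + 1 < n ∨ dim P < n) :
    Integrable (fun u => ((kFaces k (proj u P)).ncard : ℝ)) (uniformSphere n) ∧
      ∫ u, ((kFaces k (proj u P)).ncard : ℝ) ∂uniformSphere n =
        ∑ᶠ F ∈ kFaces k P, (1 - 2 * α P F / (n * ω n)) := by
  have := isProbabilityMeasure_uniformSphere hn
  by_cases h : P.Nonempty ∧ dim P = k
  · obtain ⟨hne, hd⟩ := h
    have hlt : dim P < n := hd ▸ hk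
    -- Here `k = dim P < n`, so almost surely `P_u` keeps dimension `k` and counts itself; the
    -- matching term for `P` is 1 since its own inner angle is null.
    have hae : (fun u => ((kFaces k (proj u P)).ncard : ℝ)) =ᵐ[uniformSphere n]
        fun u => ((properKFaces k (proj u P)).ncard : ℝ) + 1 := by
      filter_upwards [dim_proj_ae_of_lt hlt] with u hu
      have hne' : (proj u P).Nonempty := hne.image _
      rw [kFaces_eq_insert hne' (hu.trans hd), Set.ncard_insert_of_notMem
        (self_notMem_properKFaces _ _) ((hP.proj u).finite_properKFaces k), Nat.cast_add,
        Nat.cast_one]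
    refine ⟨((integrable_ncard_properKFaces hn hP k).add (integrable_const 1)).congr hae.symm, ?_⟩
    rw [integral_congr_ae hae, integral_add (integrable_ncard_properKFaces hn hP k)
      (integrable_const 1), integral_ncard_properKFaces hn hP, kFaces_eq_insert hne hd,
      finsum_mem_insert _ (self_notMem_properKFaces P k) (hP.finite_properKFaces k),
      α_self hP hne (dim_lt_iff.1 hlt)]
    simp [add_comm]
  · have h' : P = ∅ ∨ dim P ≠ k := by
      rcases P.eq_empty_or_nonempty with h1 | h1
      · exact Or.inl h1
      · exact Or.inr fun h2 => h ⟨h1, h2⟩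
    have hae : (fun u => ((kFaces k (proj u P)).ncard : ℝ)) =ᵐ[uniformSphere n]
        fun u => ((properKFaces k (proj u P)).ncard : ℝ) := by
      have hd : ∀ᵐ u ∂uniformSphere n, proj u P = ∅ ∨ dim (proj u P) ≠ k := by
        rcases h' with rfl | h'
        · exact ae_of_all _ fun u => Or.inl (Set.image_empty _)
        by_cases hlt : dim P < n
        · filter_upwards [dim_proj_ae_of_lt hlt] with u hu
          exact Or.inr (hu ▸ h')
        · have htop : vectorSpan ℝ P = ⊤ := not_not.1 fun h => hlt (dim_lt_iff.2 h)
          -- For full-dimensional `P`, every `P_u` has dimension `n - 1`, which `k + 1 < n`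
          -- excludes.
          refine ae_of_all _ fun u => Or.inr ?_
          have := dim_proj_of_vectorSpan_eq_top htop u
          omega
      filter_upwards [hd] with u hu
      rw [kFaces_eq_properKFaces hu]
    refine ⟨(integrable_ncard_properKFaces hn hP k).congr hae.symm, ?_⟩
    rw [integral_congr_ae hae, integral_ncard_properKFaces hn hP, kFaces_eq_properKFaces h']

end AngleProjection

theorem mainTheorem2 (n : ℕ) (hn : 0 < n) (P : Set (AngleProjection.E n))
    (hP : AngleProjection.IsPolytope P) :
    (∀ F ∈ AngleProjection.properFaces P,
      NullMeasurableSet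
        {u | AngleProjection.proj u F ∈ AngleProjection.properFaces (AngleProjection.proj u P)}
        (AngleProjection.uniformSphere n) ∧
      (AngleProjection.uniformSphere n).real
        {u | AngleProjection.proj u F ∈ AngleProjection.properFaces (AngleProjection.proj u P)} =
        1 - 2 * AngleProjection.α P F / (n * AngleProjection.ω n)) ∧
    (∀ k < n,
      Integrable
        (fun u => ((AngleProjection.properKFaces k (AngleProjection.proj u P)).ncard : ℝ))
        (AngleProjection.uniformSphere n) ∧
      ∫ u, ((AngleProjection.properKFaces k (AngleProjection.proj u P)).ncard : ℝ)
          ∂(AngleProjection.uniformSphere n) =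
        ∑ᶠ F ∈ AngleProjection.properKFaces k P,
          (1 - 2 * AngleProjection.α P F / (n * AngleProjection.ω n)) ∧
      ∑ᶠ F ∈ AngleProjection.properKFaces k P,
          (1 - 2 * AngleProjection.α P F / (n * AngleProjection.ω n)) =
        ((AngleProjection.properKFaces k P).ncard : ℝ) -
          2 / (n * AngleProjection.ω n) *
            ∑ᶠ F ∈ AngleProjection.properKFaces k P, AngleProjection.α P F) ∧
    (∀ k < n, (k + 1 < n ∨ AngleProjection.dim P < n) →
      Integrable
        (fun u => ((AngleProjection.kFaces k (AngleProjection.proj u P)).ncard : ℝ))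
        (AngleProjection.uniformSphere n) ∧
      ∫ u, ((AngleProjection.kFaces k (AngleProjection.proj u P)).ncard : ℝ)
          ∂(AngleProjection.uniformSphere n) =
        ∑ᶠ F ∈ AngleProjection.kFaces k P,
          (1 - 2 * AngleProjection.α P F / (n * AngleProjection.ω n)) ∧
      ∑ᶠ F ∈ AngleProjection.kFaces k P,
          (1 - 2 * AngleProjection.α P F / (n * AngleProjection.ω n)) =
        ((AngleProjection.kFaces k P).ncard : ℝ) -
          2 / (n * AngleProjection.ω n) *
            ∑ᶠ F ∈ AngleProjection.kFaces k P, AngleProjection.α P F) := by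
  exact ⟨fun F hF => ⟨AngleProjection.nullMeasurableSet_proj_event hP hF,
      AngleProjection.uniformSphere_real_proj_event hn hP hF⟩,
    fun k _ => ⟨AngleProjection.integrable_ncard_properKFaces hn hP k,
      AngleProjection.integral_ncard_properKFaces hn hP k,
      AngleProjection.finsum_mem_one_sub (hP.finite_properKFaces k) _ _⟩,
    fun k hk hkd => ⟨(AngleProjection.kFaces_expectation hn hP hk hkd).1,
      (AngleProjection.kFaces_expectation hn hP hk hkd).2,
      AngleProjection.finsum_mem_one_sub (hP.finite_kFaces k) _ _⟩⟩
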